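/- Let $\{X_n\}_{n\in\mathbb Z}$ be a (strictly) stationary real-valued stochastic process such that for every $n\ge 1$ the vector $(X_1,\dots,X_n)$ has a Lebesgue density $f$ on $\mathbb R^n$ with $f\log f$ integrable, so that the joint differential entropy $h(X_1,\dots,X_n)=-\int f\log f$ is finite. For $n\ge1$ let $$h(X_n\mid X_{n-1},\dots,X_1)=-\int_{\mathbb R^n} f(x_1,\dots,x_n)\,\log f(x_n\mid x_{n-1},\dots,x_1)\,dx$$ be the conditional differential entropy, where $f(x_n\mid x_{n-1},\dots,x_1)=f(x_1,\dots,x_n)/f(x_1,\dots,x_{n-1})$ (for $n=1$ it is $h(X_1)$). Then the differential entropy rate $$h(\chi)=\lim_{n\to\infty}\frac{h(X_1,\dots,X_n)}{n}$$ exists in $[-\infty,\infty)$; the differential excess entropy $$E=\sum_{n=1}^{\infty}\bigl(h(X_n\mid X_{n-1},\dots,X_1)-h(\chi)\bigr)=\lim_{n\to\infty}\bigl[h(X_1,\dots,X_n)-n\,h(\chi)\bigr]$$ is well defined in $[0,\infty]$ (in particular both expressions agree, and $E=+\infty$ if $h(\chi)=-\infty$); and the mutual information between past and future satisfies $$I_{p-f}=E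 .$$ Here $I_{p-f}=I(\{X_s,\ s<0\};\{X_s,\ s\ge 0\})\in[0,\infty]$, where $I(U;V)=\int\log\frac{dP_{(U,V)}}{d(P_U\otimes P_V)}\,dP_{(U,V)}$ if $P_{(U,V)}\ll P_U\otimes P_V$, and $I(U;V)=+\infty$ otherwise. -/

import Mathlib

open MeasureTheory ProbabilityTheory InformationTheory Filter Topology
open scoped ENNReal

namespace DiffEntropy

variable {Ω : Type*} [MeasurableSpace Ω]

/-- Strict stationarity of a two-sided real process: the law of the whole process is invariant
under time shifts. -/
def IsStationary (X : ℤ → Ω → ℝ) (μ : Measure Ω) : Prop :=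
  ∀ k : ℤ, IdentDistrib (fun ω (i : ℤ) => X (i + k) ω) (fun ω (i : ℤ) => X i ω) μ μ

/-- The random vector `(X₁, …, Xₙ)`. -/
def block (X : ℤ → Ω → ℝ) (n : ℕ) (ω : Ω) : Fin n → ℝ :=
  fun i => X ((i : ℤ) + 1) ω

/-- The density `f(x₁, …, xₙ)` of `(X₁, …, Xₙ)` with respect to Lebesgue measure on `ℝⁿ`. -/
noncomputable def density (X : ℤ → Ω → ℝ) (μ : Measure Ω) (n : ℕ) (x : Fin n → ℝ) : ℝ :=
  (pdf (block X n) μ volume x).toReal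

/-- The process is continuous-valued with finite joint differential entropies: each block
`(X₁, …, Xₙ)` has a Lebesgue density `f`, and `f log f` is Lebesgue integrable. -/
structure HasFiniteEntropies (X : ℤ → Ω → ℝ) (μ : Measure Ω) : Prop where
  hasPDF : ∀ n : ℕ, HasPDF (block X n) μ volume
  integrable : ∀ n : ℕ, Integrable (fun x => density X μ n x * Real.log (density X μ n x))

/-- Joint differential entropy `h(X₁, …, Xₙ) = -∫ f log f` (it is `0` for `n = 0`). -/
noncomputable def jointEntropy (X : ℤ → Ω → ℝ) (μ : Measure Ω) (n : ℕ) : ℝ :=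
  -∫ x, density X μ n x * Real.log (density X μ n x)

/-- Conditional differential entropy
`h(Xₙ₊₁ | Xₙ, …, X₁) = -∫ f(x₁, …, xₙ₊₁) log f(xₙ₊₁ | x₁, …, xₙ)`, where the conditional density
is `f(x₁, …, xₙ₊₁) / f(x₁, …, xₙ)`. For `n = 0` this is `h(X₁)`. -/
noncomputable def condEntropy (X : ℤ → Ω → ℝ) (μ : Measure Ω) (n : ℕ) : ℝ :=
  -∫ x : Fin (n + 1) → ℝ, density X μ (n + 1) x *
    Real.log (density X μ (n + 1) x / density X μ n (Fin.init x))

/-- Differential entropy rate `lim h(X₁, …, Xₙ) / n`, with values in `[-∞, ∞]`. -/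
noncomputable def entropyRate (X : ℤ → Ω → ℝ) (μ : Measure Ω) : EReal :=
  limUnder atTop (fun n : ℕ => ((jointEntropy X μ n / n : ℝ) : EReal))

/-- Partial sum `∑_{n=1}^{N} (h(Xₙ | Xₙ₋₁, …, X₁) - h(χ))` of the excess entropy series. -/
noncomputable def excessEntropySum (X : ℤ → Ω → ℝ) (μ : Measure Ω) (N : ℕ) : EReal :=
  ∑ n ∈ Finset.range N, ((condEntropy X μ n : EReal) - entropyRate X μ)

/-- Differential excess entropy `E = ∑_{n=1}^{∞} (h(Xₙ | Xₙ₋₁, …, X₁) - h(χ))`. -/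
noncomputable def excessEntropy (X : ℤ → Ω → ℝ) (μ : Measure Ω) : EReal :=
  limUnder atTop (excessEntropySum X μ)

/-- Mutual information: the Kullback-Leibler divergence of the joint law from the product of the
marginal laws, that is `∫ log (dP_{UV} / d(P_U ⊗ P_V)) dP_{UV}`. -/
noncomputable def mutualInfo {α β : Type*} [MeasurableSpace α] [MeasurableSpace β]
    (U : Ω → α) (V : Ω → β) (μ : Measure Ω) : ℝ≥0∞ :=
  klDiv (μ.map (fun ω => (U ω, V ω))) ((μ.map U).prod (μ.map V))

/-- Mutual information between the infinite past `{X_s, s < 0}` and the infinite future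
`{X_s, s ≥ 0}`. -/
noncomputable def pastFutureInfo (X : ℤ → Ω → ℝ) (μ : Measure Ω) : ℝ≥0∞ :=
  mutualInfo (fun ω (s : Set.Iio (0 : ℤ)) => X s ω) (fun ω (s : Set.Ici (0 : ℤ)) => X s ω) μ

end DiffEntropy

/-! Write H(n) for `jointEntropy X μ n`. By stationarity the mutual information between m variables
and the next n is H(m) + H(n) - H(m+n) (`mutualInfo_block_shiftBlock`). For m = 1 it grows with n,
so the increments H(n+1) - H(n) decrease to some r in [-∞, ∞); averaging gives H(n)/n → r, and the
excess series telescopes to H(N) - N r.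

Past-future information is determined by finite windows: data processing bounds each window from
above, and martingale convergence with Fatou's lemma (`klDiv_le_of_forall_klDiv_map_le`) gives the
converse. For finite r, a window (n, n) carries at most H(n) - n r because H(2n) - H(n) ≥ n r, while
the (m, n) windows tend to H(m) - m r as n → ∞; the two suprema coincide. For r = -∞ the windows (1,
n) already have unbounded information. -/

namespace DiffEntropy

/-! ### Divergence along increasing σ-algebras -/

section KLLimit

variable {α : Type*} {mα : MeasurableSpace α} {P Q : Measure α}

/-- Fenchel-Young inequality for `klFun`, whose convex conjugate is `t ↦ exp t - 1`. -/
lemma mul_le_klFun_add_exp {x : ℝ} (hx : 0 ≤ x) (t : ℝ) : t * x ≤ klFun x + Real.exp t := by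
  rcases hx.eq_or_lt with rfl | hx
  · simp [klFun_zero]; positivity
  · have h := Real.add_one_le_exp (t - Real.log x)
    rw [Real.exp_sub, Real.exp_log hx, le_div_iff₀ hx] at h
    rw [klFun_apply]
    linarith

lemma ofReal_mul_measure_le_klDiv_add [IsFiniteMeasure P] [IsFiniteMeasure Q]
    {t : ℝ} (ht : 0 ≤ t) (s : Set α) :
    ENNReal.ofReal t * P s ≤ klDiv P Q + ENNReal.ofReal (Real.exp t) * Q s := by
  by_cases hPQ : P ≪ Q
  swap
  · simp [klDiv_of_not_ac hPQ]
  calc ENNReal.ofReal t * P s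
      = ∫⁻ x in s, ENNReal.ofReal t * P.rnDeriv Q x ∂Q := by
        rw [lintegral_const_mul _ (Measure.measurable_rnDeriv _ _),
          Measure.setLIntegral_rnDeriv hPQ]
    _ ≤ ∫⁻ x in s, (ENNReal.ofReal (klFun (P.rnDeriv Q x).toReal)
          + ENNReal.ofReal (Real.exp t)) ∂Q := by
        refine lintegral_mono_ae ?_
        filter_upwards [ae_restrict_of_ae (P.rnDeriv_ne_top Q)] with x hx
        rw [← ENNReal.ofReal_toReal hx, ← ENNReal.ofReal_mul ht, ENNReal.toReal_ofReal (by simp),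
          ← ENNReal.ofReal_add (klFun_nonneg (by simp)) (Real.exp_nonneg t)]
        exact ENNReal.ofReal_le_ofReal (mul_le_klFun_add_exp (by simp) t)
    _ ≤ klDiv P Q + ENNReal.ofReal (Real.exp t) * Q s := by
        rw [lintegral_add_right _ measurable_const, klDiv_eq_lintegral_klFun_of_ac hPQ,
          lintegral_const, Measure.restrict_apply MeasurableSet.univ, Set.univ_inter]
        gcongr
        exact Measure.restrict_le_self

variable {β : ℕ → Type*} [mβ : ∀ n, MeasurableSpace (β n)] {g : ∀ n, α → β n}

lemma exists_comap_measure_symmDiff_lt [IsFiniteMeasure P]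
    (hmono : Monotone fun n => (mβ n).comap (g n)) (hsup : ⨆ n, (mβ n).comap (g n) = mα)
    {s : Set α} (hs : MeasurableSet s) {ε : ℝ≥0∞} (hε : 0 < ε) :
    ∃ n, ∃ t : Set (β n), MeasurableSet t ∧ P (symmDiff (g n ⁻¹' t) s) < ε := by
  let C : Set (Set α) := ⋃ n, {t | MeasurableSet[(mβ n).comap (g n)] t}
  have hmem : ∀ a, a ∈ C ↔ ∃ n, MeasurableSet[(mβ n).comap (g n)] a := by simp [C]
  have hC : IsSetRing C := by
    refine ⟨(hmem _).2 ⟨0, @MeasurableSet.empty _ (_)⟩, ?_, ?_⟩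
    · intro a b ha hb
      obtain ⟨n, hn⟩ := (hmem _).1 ha
      obtain ⟨k, hk⟩ := (hmem _).1 hb
      exact (hmem _).2 ⟨max n k, MeasurableSet.union (hmono (le_max_left n k) _ hn)
        (hmono (le_max_right n k) _ hk)⟩
    · intro a b ha hb
      obtain ⟨n, hn⟩ := (hmem _).1 ha
      obtain ⟨k, hk⟩ := (hmem _).1 hb
      exact (hmem _).2 ⟨max n k, MeasurableSet.diff (hmono (le_max_left n k) _ hn)
        (hmono (le_max_right n k) _ hk)⟩
  have huniv : Set.univ ∈ C := (hmem _).2 ⟨0, @MeasurableSet.univ _ (_)⟩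
  have hgen : mα = MeasurableSpace.generateFrom C :=
    hsup.symm.trans (MeasurableSpace.generateFrom_iUnion_measurableSet _).symm
  obtain ⟨t, ht, hts⟩ := exists_measure_symmDiff_lt_of_generateFrom_isSetRing (μ := P) hC
    ⟨{Set.univ}, Set.countable_singleton _, by simpa using huniv, by simp⟩ hgen hs hε
  obtain ⟨n, u, hu, rfl⟩ := (hmem _).1 ht
  exact ⟨n, u, hu, hts⟩

/-- A `Q`-null set is approximated by a finite-level set that is almost `Q`-null; the integrated
Fenchel-Young inequality with t = k at that level bounds `k * P s` independently of k, forcing `P s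
= 0`. -/
lemma absolutelyContinuous_of_klDiv_map_le [IsFiniteMeasure P] [IsFiniteMeasure Q]
    (hg : ∀ n, Measurable (g n))
    (hmono : Monotone fun n => (mβ n).comap (g n)) (hsup : ⨆ n, (mβ n).comap (g n) = mα)
    {C : ℝ≥0∞} (hC : C ≠ ∞) (hle : ∀ n, klDiv (P.map (g n)) (Q.map (g n)) ≤ C) : P ≪ Q := by
  refine Measure.AbsolutelyContinuous.mk fun s hs hQs => ?_
  have key : ∀ k : ℕ, (k : ℝ≥0∞) * P s ≤ C + 1 := by
    intro k
    refine ENNReal.le_of_forall_pos_le_add fun ε hε _ => ?_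
    -- The approximation error is weighted by k on the `P` side and by exp k on the `Q` side; error
    -- ε / D makes the total ε.
    set D : ℝ≥0∞ := k + ENNReal.ofReal (Real.exp k) with hD
    have hDtop : D ≠ ∞ := by simp [hD]
    have hD0 : D ≠ 0 := by
      simp only [hD, ne_eq, add_eq_zero, not_and]
      intro _ h
      exact absurd (ENNReal.ofReal_eq_zero.1 h) (not_le.2 (Real.exp_pos _))
    obtain ⟨n, t, ht, hts⟩ := exists_comap_measure_symmDiff_lt (P := P + Q) hmono hsup hs
      (ε := ε / D) (ENNReal.div_pos (by simpa using hε.ne') hDtop)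
    have hPs : P s ≤ P (g n ⁻¹' t) + ε / D := by
      calc P s ≤ P (g n ⁻¹' t ∪ symmDiff (g n ⁻¹' t) s) := by
            refine measure_mono fun x hx => ?_
            by_cases hxt : x ∈ g n ⁻¹' t
            · exact Or.inl hxt
            · exact Or.inr (Or.inr ⟨hx, hxt⟩)
        _ ≤ P (g n ⁻¹' t) + P (symmDiff (g n ⁻¹' t) s) := measure_union_le _ _
        _ ≤ _ := by
            gcongr
            exact (le_self_add.trans_eq (Measure.add_apply P Q _).symm).trans hts.le
    have hQt : Q (g n ⁻¹' t) ≤ ε / D := by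
      calc Q (g n ⁻¹' t) ≤ Q (s ∪ symmDiff (g n ⁻¹' t) s) := by
            refine measure_mono fun x hx => ?_
            by_cases hxs : x ∈ s
            · exact Or.inl hxs
            · exact Or.inr (Or.inl ⟨hx, hxs⟩)
        _ ≤ Q s + Q (symmDiff (g n ⁻¹' t) s) := measure_union_le _ _
        _ ≤ _ := by
            rw [hQs, zero_add]
            exact (le_add_self.trans_eq (Measure.add_apply P Q _).symm).trans hts.le
    have hkl := ofReal_mul_measure_le_klDiv_add (P := P.map (g n)) (Q := Q.map (g n))
      (Nat.cast_nonneg k) t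
    rw [Measure.map_apply (hg n) ht, Measure.map_apply (hg n) ht, ENNReal.ofReal_natCast] at hkl
    calc (k : ℝ≥0∞) * P s ≤ k * (P (g n ⁻¹' t) + ε / D) := by gcongr
      _ = k * P (g n ⁻¹' t) + k * (ε / D) := mul_add _ _ _
      _ ≤ (C + ENNReal.ofReal (Real.exp k) * (ε / D)) + k * (ε / D) := by
          gcongr
          exact hkl.trans (by gcongr; exact hle n)
      _ = C + D * (ε / D) := by rw [hD]; ring
      _ = C + ε := by rw [ENNReal.mul_div_cancel hD0 hDtop]
      _ ≤ C + 1 + ε := by gcongr; exact le_self_add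
  by_contra h0
  have : P s ≤ 0 := by
    have hlim : Tendsto (fun k : ℕ => (C + 1) / (k : ℝ≥0∞)) atTop (𝓝 0) := by
      simpa using ENNReal.Tendsto.const_div (a := C + 1) ENNReal.tendsto_nat_nhds_top
        (Or.inr (by simp [hC]))
    refine ge_of_tendsto hlim (Filter.eventually_atTop.2 ⟨1, fun k hk => ?_⟩)
    rw [ENNReal.le_div_iff_mul_le (Or.inl (by simp; omega)) (Or.inl (by simp)), mul_comm]
    exact key k
  exact h0 (le_zero_iff.1 this)

/-- The Kullback-Leibler divergence is determined by its values along maps that generate an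
increasing sequence of σ-algebras with supremum the whole σ-algebra. -/
theorem klDiv_le_of_forall_klDiv_map_le [IsFiniteMeasure P] [IsFiniteMeasure Q]
    (hg : ∀ n, Measurable (g n))
    (hmono : Monotone fun n => (mβ n).comap (g n)) (hsup : ⨆ n, (mβ n).comap (g n) = mα)
    {C : ℝ≥0∞} (hle : ∀ n, klDiv (P.map (g n)) (Q.map (g n)) ≤ C) : klDiv P Q ≤ C := by
  by_cases hC : C = ∞
  · simp [hC]
  have hPQ := absolutelyContinuous_of_klDiv_map_le hg hmono hsup hC hle
  let ℱ : Filtration ℕ mα := ⟨fun n => (mβ n).comap (g n), hmono, fun n => (hg n).comap_le⟩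
  -- Conditional expectations of dP/dQ are the densities of the pushed-forward measures, so Lévy's
  -- upward theorem gives their a.e. convergence and Fatou applies to `klFun` of them.
  have hlim := tendsto_ae_condExp (ℱ := ℱ) (μ := Q) (fun x => (P.rnDeriv Q x).toReal)
  have hself : Q[fun x => (P.rnDeriv Q x).toReal | ⨆ n, ℱ n] =
      fun x => (P.rnDeriv Q x).toReal := by
    have h : (⨆ n, ℱ n) = mα := hsup
    rw [h]
    exact condExp_of_stronglyMeasurable le_rfl
      (Measure.measurable_rnDeriv P Q).ennreal_toReal.stronglyMeasurable
      Measure.integrable_toReal_rnDeriv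
  rw [hself] at hlim
  have hmap := ae_all_iff.2 fun n => toReal_rnDeriv_map hPQ (hg n)
  rw [klDiv_eq_lintegral_klFun_of_ac hPQ]
  calc ∫⁻ x, ENNReal.ofReal (klFun (P.rnDeriv Q x).toReal) ∂Q
      = ∫⁻ x, liminf (fun n => ENNReal.ofReal
          (klFun ((P.map (g n)).rnDeriv (Q.map (g n)) (g n x)).toReal)) atTop ∂Q := by
        refine lintegral_congr_ae ?_
        filter_upwards [hlim, hmap] with x hx hm
        refine (Tendsto.liminf_eq ?_).symm
        simp_rw [hm]
        exact (ENNReal.continuous_ofReal.tendsto _).comp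
          ((continuous_klFun.tendsto _).comp hx)
    _ ≤ liminf (fun n => ∫⁻ x, ENNReal.ofReal
          (klFun ((P.map (g n)).rnDeriv (Q.map (g n)) (g n x)).toReal) ∂Q) atTop :=
        lintegral_liminf_le fun n => by
          have := hg n
          fun_prop
    _ ≤ C := by
        refine liminf_le_of_le (by isBoundedDefault) fun b hb => ?_
        obtain ⟨n, hn⟩ := hb.exists
        refine hn.trans ((le_of_eq ?_).trans (hle n))
        rw [klDiv_eq_lintegral_klFun_of_ac (hPQ.map (hg n)), lintegral_map _ (hg n)]
        fun_prop

end KLLimit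

/-! ### Log-likelihood ratios and concatenation of vectors -/

section Densities

/-- On a `Q`-null set, the part with q ≠ 0 is ν-null and the rest is `P`-null, whence `P ≪ Q`; the
formula is then the chain rule for Radon-Nikodym derivatives. -/
lemma llr_withDensity_ae_eq {α : Type*} {mα : MeasurableSpace α} {ν P Q : Measure α}
    [SigmaFinite ν] [IsFiniteMeasure P] [IsFiniteMeasure Q] {p q : α → ℝ≥0∞} (hp : Measurable p)
    (hq : Measurable q) (hP : P = ν.withDensity p) (hQ : Q = ν.withDensity q)
    (hPq : ∀ᵐ x ∂P, q x ≠ 0) :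
    P ≪ Q ∧ llr P Q =ᵐ[P] fun x => Real.log (p x).toReal - Real.log (q x).toReal := by
  have hPν : P ≪ ν := hP ▸ withDensity_absolutelyContinuous _ _
  have hPQ : P ≪ Q := by
    refine Measure.AbsolutelyContinuous.mk fun s hs hQs => ?_
    rw [hQ, withDensity_apply_eq_zero hq] at hQs
    refine measure_mono_null (t := {x | q x ≠ 0} ∩ s ∪ {x | ¬ q x ≠ 0}) ?_ ?_
    · intro x hx
      by_cases h : q x ≠ 0
      · exact Or.inl ⟨h, hx⟩
      · exact Or.inr h
    · exact measure_union_null (hPν hQs) (ae_iff.1 hPq)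
  refine ⟨hPQ, ?_⟩
  have h1 : P.rnDeriv ν =ᵐ[ν] p := by rw [hP]; exact Measure.rnDeriv_withDensity ν hp
  have h2 : Q.rnDeriv ν =ᵐ[ν] q := by rw [hQ]; exact Measure.rnDeriv_withDensity ν hq
  have h3 := Measure.rnDeriv_mul_rnDeriv (κ := ν) hPQ
  filter_upwards [hPν h1, hPν h2, hPν h3, hPq, hPν (Q.rnDeriv_ne_top ν),
    Measure.rnDeriv_pos hPQ, hPQ (P.rnDeriv_ne_top Q)] with x h1 h2 h3 hq0 hqt hpos htop
  rw [h2] at hqt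
  have h4 : p x = P.rnDeriv Q x * q x := by rw [← h1, ← h3, Pi.mul_apply, h2]
  rw [h4, llr, ENNReal.toReal_mul, Real.log_mul, add_sub_cancel_right]
  · exact (ENNReal.toReal_pos hpos.ne' htop).ne'
  · exact (ENNReal.toReal_pos hq0 hqt).ne'

/-- Concatenation of vectors, as a measurable equivalence. -/
noncomputable def appendMeasurableEquiv (m n : ℕ) :
    (Fin m → ℝ) × (Fin n → ℝ) ≃ᵐ (Fin (m + n) → ℝ) :=
  (MeasurableEquiv.sumPiEquivProdPi (fun _ : Fin m ⊕ Fin n => ℝ)).symm.trans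
    (MeasurableEquiv.piCongrLeft (fun _ => ℝ) finSumFinEquiv)

lemma appendMeasurableEquiv_apply (m n : ℕ) (x : Fin (m + n) → ℝ) :
    appendMeasurableEquiv m n (fun i => x (Fin.castAdd n i), fun i => x (Fin.natAdd m i)) = x := by
  funext j
  obtain ⟨j, rfl⟩ := finSumFinEquiv.surjective j
  simp only [appendMeasurableEquiv, MeasurableEquiv.trans_apply, MeasurableEquiv.coe_piCongrLeft,
    Equiv.piCongrLeft_apply_apply]
  rcases j with j | j <;> rfl

lemma measurePreserving_appendMeasurableEquiv (m n : ℕ) :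
    MeasurePreserving (appendMeasurableEquiv m n) :=
  (volume_measurePreserving_piCongrLeft (fun _ => ℝ) finSumFinEquiv).comp
    (volume_measurePreserving_sumPiEquivProdPi (fun _ : Fin m ⊕ Fin n => ℝ)).symm

end Densities

section Concatenation

variable {Ω : Type*}

/-- The block `(X_{k+1}, …, X_{k+n})`. -/
def shiftBlock (X : ℤ → Ω → ℝ) (k : ℤ) (n : ℕ) (ω : Ω) : Fin n → ℝ :=
  fun i => X ((i : ℤ) + 1 + k) ω

lemma appendMeasurableEquiv_block (X : ℤ → Ω → ℝ) (m n : ℕ) (ω : Ω) :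
    appendMeasurableEquiv m n (block X m ω, shiftBlock X m n ω) = block X (m + n) ω := by
  convert! appendMeasurableEquiv_apply m n (block X (m + n) ω) using 3
  funext i
  simp only [shiftBlock, block, Fin.val_natAdd]
  congr 1
  push_cast
  ring

end Concatenation

/-! ### Entropies and mutual information of finite blocks -/

section Blocks

variable {Ω : Type*} [MeasurableSpace Ω] {μ : Measure Ω} {X : ℤ → Ω → ℝ}

lemma measurable_block (hX : ∀ i, Measurable (X i)) (n : ℕ) : Measurable (block X n) :=
  measurable_pi_lambda _ fun _ => hX _

lemma measurable_density (n : ℕ) : Measurable (density X μ n) :=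
  (measurable_pdf _ _ _).ennreal_toReal

lemma measurable_shiftBlock (hX : ∀ i, Measurable (X i)) (k : ℤ) (n : ℕ) :
    Measurable (shiftBlock X k n) :=
  measurable_pi_lambda _ fun _ => hX _

lemma IsStationary.identDistrib_shiftBlock (hstat : IsStationary X μ) (k : ℤ) (n : ℕ) :
    IdentDistrib (shiftBlock X k n) (block X n) μ μ :=
  (hstat k).comp (u := fun (x : ℤ → ℝ) (i : Fin n) => x ((i : ℤ) + 1))
    (measurable_pi_lambda _ fun _ => measurable_pi_apply _)

lemma map_shiftBlock_prod_eq_withDensity (hX : ∀ i, Measurable (X i))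
    (hent : HasFiniteEntropies X μ) (m n : ℕ) :
    μ.map (fun ω => (block X m ω, shiftBlock X m n ω)) =
      (volume.prod volume).withDensity
        (fun z => pdf (block X (m + n)) μ volume (appendMeasurableEquiv m n z)) := by
  have := hent.hasPDF (m + n)
  set e := appendMeasurableEquiv m n
  have hU := measurable_block hX m
  have hV := measurable_shiftBlock hX m n
  have hpres : (volume.prod volume : Measure ((Fin m → ℝ) × (Fin n → ℝ))).map e = volume :=
    (measurePreserving_appendMeasurableEquiv m n).map_eq
  have hmap : (μ.map (fun ω => (block X m ω, shiftBlock X m n ω))).map e =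
      volume.withDensity (pdf (block X (m + n)) μ volume) := by
    rw [← map_eq_withDensity_pdf (block X (m + n)) μ volume, Measure.map_map e.measurable (hU.prodMk hV)]
    congr 1
    funext ω
    exact appendMeasurableEquiv_block X m n ω
  refine e.map_measurableEquiv_injective ?_
  rw [hmap]
  ext s hs
  rw [Measure.map_apply e.measurable hs, withDensity_apply _ hs,
    withDensity_apply _ (e.measurable hs), ← setLIntegral_map hs (measurable_pdf _ _ _)
      e.measurable, hpres]

variable [IsProbabilityMeasure μ]

lemma HasFiniteEntropies.integrable_log_density (hent : HasFiniteEntropies X μ) (n : ℕ) :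
    Integrable (fun ω => Real.log (density X μ n (block X n ω))) μ := by
  have := hent.hasPDF n
  exact (pdf.integrable_pdf_smul_iff
    (measurable_density n).log.aestronglyMeasurable).1 (hent.integrable n)

lemma HasFiniteEntropies.integral_log_density (hent : HasFiniteEntropies X μ) (n : ℕ) :
    ∫ ω, Real.log (density X μ n (block X n ω)) ∂μ = -jointEntropy X μ n := by
  have := hent.hasPDF n
  rw [jointEntropy, neg_neg]
  exact (pdf.integral_pdf_smul (measurable_density n).log.aestronglyMeasurable).symm

/-- This positivity lets logarithms of products and quotients split despite the convention `Real.log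
0 = 0`. -/
lemma HasFiniteEntropies.ae_map_density_ne_zero (hent : HasFiniteEntropies X μ) (n : ℕ) :
    ∀ᵐ x ∂(μ.map (block X n)), density X μ n x ≠ 0 := by
  have := hent.hasPDF n
  have hac : μ.map (block X n) ≪ volume := HasPDF.absolutelyContinuous
  filter_upwards [Measure.rnDeriv_pos hac, hac (Measure.rnDeriv_ne_top (μ.map (block X n)) volume)]
    with x hx hx'
  exact (ENNReal.toReal_pos hx.ne' hx').ne'

lemma HasFiniteEntropies.ae_density_ne_zero (hX : ∀ i, Measurable (X i))
    (hent : HasFiniteEntropies X μ) (n : ℕ) : ∀ᵐ ω ∂μ, density X μ n (block X n ω) ≠ 0 :=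
  ae_of_ae_map (measurable_block hX n).aemeasurable (hent.ae_map_density_ne_zero n)

lemma condEntropy_eq (hX : ∀ i, Measurable (X i)) (hent : HasFiniteEntropies X μ) (n : ℕ) :
    condEntropy X μ n = jointEntropy X μ (n + 1) - jointEntropy X μ n := by
  have := hent.hasPDF (n + 1)
  have hmeas : Measurable fun x : Fin (n + 1) → ℝ =>
      Real.log (density X μ (n + 1) x / density X μ n (Fin.init x)) :=
    ((measurable_density (n + 1)).div ((measurable_density n).comp
      (measurable_pi_lambda _ fun _ => measurable_pi_apply _))).log
  have h1 : condEntropy X μ n = -∫ ω, Real.log (density X μ (n + 1) (block X (n + 1) ω) /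
      density X μ n (Fin.init (block X (n + 1) ω))) ∂μ :=
    congrArg Neg.neg (pdf.integral_pdf_smul hmeas.aestronglyMeasurable)
  have h2 : ∀ᵐ ω ∂μ, Real.log (density X μ (n + 1) (block X (n + 1) ω) /
      density X μ n (Fin.init (block X (n + 1) ω))) =
      Real.log (density X μ (n + 1) (block X (n + 1) ω)) -
        Real.log (density X μ n (block X n ω)) := by
    filter_upwards [hent.ae_density_ne_zero hX (n + 1), hent.ae_density_ne_zero hX n] with ω ha hb
    -- `Fin.init` of the block of length n + 1 is definitionally the block of length n.
    exact Real.log_div ha hb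
  rw [h1, integral_congr_ae h2, integral_sub (hent.integrable_log_density _)
    (hent.integrable_log_density _), hent.integral_log_density, hent.integral_log_density]
  ring

/-- The log-likelihood ratio is the joint log density minus the two marginal ones, and each has
expectation minus an entropy. Nonnegativity is recorded so that `ENNReal.ofReal` loses nothing. -/
lemma mutualInfo_block_shiftBlock (hX : ∀ i, Measurable (X i)) (hstat : IsStationary X μ)
    (hent : HasFiniteEntropies X μ) (m n : ℕ) :
    0 ≤ jointEntropy X μ m + jointEntropy X μ n - jointEntropy X μ (m + n) ∧
    mutualInfo (block X m) (shiftBlock X m n) μ =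
      ENNReal.ofReal (jointEntropy X μ m + jointEntropy X μ n - jointEntropy X μ (m + n)) := by
  have := hent.hasPDF m
  have := hent.hasPDF n
  have hU := measurable_block hX m
  have hV := measurable_shiftBlock hX m n
  have hVid := hstat.identDistrib_shiftBlock m n
  have : IsProbabilityMeasure (μ.map (block X m)) := Measure.isProbabilityMeasure_map hU.aemeasurable
  have : IsProbabilityMeasure (μ.map (shiftBlock X m n)) :=
    Measure.isProbabilityMeasure_map hV.aemeasurable
  have : IsProbabilityMeasure (μ.map (fun ω => (block X m ω, shiftBlock X m n ω))) :=
    Measure.isProbabilityMeasure_map (hU.prodMk hV).aemeasurable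
  set P := μ.map (fun ω => (block X m ω, shiftBlock X m n ω)) with hP
  set Q := (μ.map (block X m)).prod (μ.map (shiftBlock X m n)) with hQ
  have hQd : Q = (volume.prod volume).withDensity
      (fun z => pdf (block X m) μ volume z.1 * pdf (block X n) μ volume z.2) := by
    rw [hQ, hVid.map_eq, map_eq_withDensity_pdf (block X m) μ, map_eq_withDensity_pdf (block X n) μ,
      prod_withDensity (measurable_pdf _ _ _) (measurable_pdf _ _ _)]
  have hUne : ∀ᵐ z ∂P, density X μ m z.1 ≠ 0 := by
    refine ae_of_ae_map (p := fun x => density X μ m x ≠ 0) measurable_fst.aemeasurable ?_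
    rw [hP, Measure.map_map measurable_fst (hU.prodMk hV)]
    exact hent.ae_map_density_ne_zero m
  have hVne : ∀ᵐ z ∂P, density X μ n z.2 ≠ 0 := by
    refine ae_of_ae_map (p := fun x => density X μ n x ≠ 0) measurable_snd.aemeasurable ?_
    rw [hP, Measure.map_map measurable_snd (hU.prodMk hV)]
    have h := hent.ae_map_density_ne_zero n
    rw [← hVid.map_eq] at h
    exact h
  obtain ⟨hPQ, hllr⟩ : P ≪ Q ∧ llr P Q =ᵐ[P] _ := llr_withDensity_ae_eq
    ((measurable_pdf (block X (m + n)) μ volume).comp (appendMeasurableEquiv m n).measurable)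
    (((measurable_pdf (block X m) μ volume).comp measurable_fst).mul
      ((measurable_pdf (block X n) μ volume).comp measurable_snd))
    (map_shiftBlock_prod_eq_withDensity hX hent m n) hQd
    (by
      filter_upwards [hUne, hVne] with z h1 h2
      exact mul_ne_zero (ENNReal.toReal_ne_zero.1 h1).1 (ENNReal.toReal_ne_zero.1 h2).1)
  let G : (Fin m → ℝ) × (Fin n → ℝ) → ℝ := fun z =>
    Real.log (density X μ (m + n) (appendMeasurableEquiv m n z)) -
      (Real.log (density X μ m z.1) + Real.log (density X μ n z.2))
  have hG : Measurable G :=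
    ((measurable_density _).comp (appendMeasurableEquiv m n).measurable).log.sub
      (((measurable_density _).comp measurable_fst).log.add
        ((measurable_density _).comp measurable_snd).log)
  have hllrG : llr P Q =ᵐ[P] G := by
    filter_upwards [hllr, hUne, hVne] with z h h1 h2
    rw [h]
    simp only [G, Pi.mul_apply, Function.comp_apply, ENNReal.toReal_mul]
    rw [← Real.log_mul h1 h2]
    rfl
  have hGcomp : ∀ ω, G (block X m ω, shiftBlock X m n ω) =
      Real.log (density X μ (m + n) (block X (m + n) ω)) -
        (Real.log (density X μ m (block X m ω)) +
          Real.log (density X μ n (shiftBlock X m n ω))) := fun ω => by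
    simp only [G, appendMeasurableEquiv_block]
  have hVlog : IdentDistrib (fun ω => Real.log (density X μ n (shiftBlock X m n ω)))
      (fun ω => Real.log (density X μ n (block X n ω))) μ μ :=
    hVid.comp (measurable_density n).log
  have hi := hent.integrable_log_density (m + n)
  have hi1 := hent.integrable_log_density m
  have hi2 := hVlog.integrable_iff.2 (hent.integrable_log_density n)
  have hi12 : Integrable (fun ω => Real.log (density X μ m (block X m ω)) +
      Real.log (density X μ n (shiftBlock X m n ω))) μ := hi1.add hi2
  have hGint : Integrable G P := by
    rw [hP, integrable_map_measure hG.aestronglyMeasurable (hU.prodMk hV).aemeasurable]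
    exact (hi.sub hi12).congr (ae_of_all _ fun ω => (hGcomp ω).symm)
  have hGval : ∫ z, llr P Q z ∂P =
      jointEntropy X μ m + jointEntropy X μ n - jointEntropy X μ (m + n) := by
    rw [integral_congr_ae hllrG, hP,
      integral_map (hU.prodMk hV).aemeasurable hG.aestronglyMeasurable,
      integral_congr_ae (ae_of_all _ hGcomp), integral_sub hi hi12,
      integral_add hi1 hi2, hVlog.integral_eq, hent.integral_log_density,
      hent.integral_log_density, hent.integral_log_density]
    ring
  have hllrint : Integrable (llr P Q) P := hGint.congr hllrG.symm
  -- The total-mass correction in `klDiv` cancels for probability measures.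
  have hnonneg := integral_llr_add_sub_measure_univ_nonneg hPQ hllrint
  have hkl := klDiv_of_ac_of_integrable hPQ hllrint
  simp only [probReal_univ, add_sub_cancel_right, hGval] at hnonneg hkl
  exact ⟨hnonneg, hkl⟩

end Blocks

/-! ### Data processing for mutual information -/

section MutualInfo

variable {Ω α β γ δ : Type*} [MeasurableSpace Ω] [MeasurableSpace α] [MeasurableSpace β]
  [MeasurableSpace γ] [MeasurableSpace δ] {μ : Measure Ω}

lemma mutualInfo_congr {U U' : Ω → α} {V V' : Ω → β}
    (h : IdentDistrib (fun ω => (U ω, V ω)) (fun ω => (U' ω, V' ω)) μ μ) :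
    mutualInfo U V μ = mutualInfo U' V' μ := by
  have h1 : μ.map U = μ.map U' := (h.comp measurable_fst).map_eq
  have h2 : μ.map V = μ.map V' := (h.comp measurable_snd).map_eq
  rw [mutualInfo, mutualInfo, h.map_eq, h1, h2]

lemma map_prodMap_mutualInfo [IsFiniteMeasure μ] {U : Ω → α} {V : Ω → β} (hU : Measurable U)
    (hV : Measurable V) {f : α → γ} {g : β → δ} (hf : Measurable f) (hg : Measurable g) :
    mutualInfo (f ∘ U) (g ∘ V) μ = klDiv ((μ.map fun ω => (U ω, V ω)).map (Prod.map f g))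
      (((μ.map U).prod (μ.map V)).map (Prod.map f g)) := by
  rw [mutualInfo, ← Measure.map_prod_map _ _ hf hg, Measure.map_map hf hU, Measure.map_map hg hV,
    Measure.map_map (hf.prodMap hg) (hU.prodMk hV)]
  rfl

lemma mutualInfo_comp_le [IsFiniteMeasure μ] {U : Ω → α} {V : Ω → β} (hU : Measurable U)
    (hV : Measurable V) {f : α → γ} {g : β → δ} (hf : Measurable f) (hg : Measurable g) :
    mutualInfo (f ∘ U) (g ∘ V) μ ≤ mutualInfo U V μ := by
  rw [map_prodMap_mutualInfo hU hV hf hg]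
  exact klDiv_map_le _ _ (hf.prodMap hg)

end MutualInfo

/-! ### Finite windows of past and future -/

section PastFuture

/-- The `m` most recent coordinates of a past trajectory. -/
def lastPast (m : ℕ) (u : Set.Iio (0 : ℤ) → ℝ) : Fin m → ℝ :=
  fun i => u ⟨(i : ℤ) - m, by have := i.2; simp only [Set.mem_Iio]; omega⟩

/-- The first `n` coordinates of a future trajectory. -/
def firstFuture (n : ℕ) (v : Set.Ici (0 : ℤ) → ℝ) : Fin n → ℝ :=
  fun i => v ⟨(i : ℤ), by simp⟩

lemma measurable_lastPast (m : ℕ) : Measurable (lastPast m) :=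
  measurable_pi_lambda _ fun _ => measurable_pi_apply _

lemma measurable_firstFuture (n : ℕ) : Measurable (firstFuture n) :=
  measurable_pi_lambda _ fun _ => measurable_pi_apply _

lemma monotone_comap_window : Monotone fun n : ℕ =>
    MeasurableSpace.comap (Prod.map (lastPast n) (firstFuture n)) inferInstance := by
  intro n k hnk
  -- Past windows list the oldest entry first, so the n most recent of k entries start at offset k -
  -- n.
  let r : (Fin k → ℝ) × (Fin k → ℝ) → (Fin n → ℝ) × (Fin n → ℝ) := fun z =>
    (fun i => z.1 ⟨i + (k - n), by omega⟩, fun i => z.2 ⟨i, by omega⟩)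
  have hr : Measurable r := by fun_prop
  have h : Prod.map (lastPast n) (firstFuture n) =
      r ∘ Prod.map (lastPast k) (firstFuture k) := by
    funext z
    refine Prod.ext (funext fun i => ?_) rfl
    simp only [Prod.map, lastPast, r, Function.comp_apply]
    refine congrArg z.1 (Subtype.ext ?_)
    push_cast [Nat.cast_sub hnk]
    ring
  simp only [h]
  rw [← MeasurableSpace.comap_comp]
  exact MeasurableSpace.comap_mono hr.comap_le

lemma iSup_comap_window : ⨆ n : ℕ,
    MeasurableSpace.comap (Prod.map (lastPast n) (firstFuture n)) inferInstance =
      (inferInstance : MeasurableSpace ((Set.Iio (0 : ℤ) → ℝ) × (Set.Ici (0 : ℤ) → ℝ))) := by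
  refine le_antisymm (iSup_le fun n =>
    ((measurable_lastPast n).prodMap (measurable_firstFuture n)).comap_le) ?_
  set m := ⨆ n : ℕ, MeasurableSpace.comap (Prod.map (lastPast n) (firstFuture n)) inferInstance
    with hm
  have hle : ∀ n, Measurable[m] (Prod.map (lastPast n) (firstFuture n)) := fun n =>
    (comap_measurable _).mono (le_iSup (fun n : ℕ => MeasurableSpace.comap
      (Prod.map (lastPast n) (firstFuture n)) inferInstance) n) le_rfl
  refine sup_le ?_ ?_
  · rw [MeasurableSpace.pi, MeasurableSpace.comap_iSup]
    refine iSup_le fun s => ?_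
    rw [MeasurableSpace.comap_comp, ← measurable_iff_comap_le]
    have hs : (s : ℤ) < 0 := s.2
    obtain ⟨k, hk⟩ := Int.eq_ofNat_of_zero_le (a := -(s : ℤ)) (by omega)
    have hk0 : 0 < k := by omega
    -- Time s = -k is the oldest entry of the past window of length k.
    have h := (measurable_pi_apply (⟨0, hk0⟩ : Fin k)).comp (measurable_fst.comp (hle k))
    convert! h using 1
    funext z
    simp only [Function.comp_apply, Prod.map, lastPast]
    refine congrArg z.1 (Subtype.ext ?_)
    push_cast
    omega
  · rw [MeasurableSpace.pi, MeasurableSpace.comap_iSup]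
    refine iSup_le fun s => ?_
    rw [MeasurableSpace.comap_comp, ← measurable_iff_comap_le]
    have hs : 0 ≤ (s : ℤ) := s.2
    obtain ⟨k, hk⟩ := Int.eq_ofNat_of_zero_le hs
    have h := (measurable_pi_apply (⟨k, Nat.lt_succ_self k⟩ : Fin (k + 1))).comp
      (measurable_snd.comp (hle (k + 1)))
    convert! h using 1
    funext z
    simp only [Function.comp_apply, Prod.map, firstFuture]
    exact congrArg z.2 (Subtype.ext hk)

variable {Ω : Type*} [MeasurableSpace Ω] {μ : Measure Ω} {X : ℤ → Ω → ℝ}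

lemma mutualInfo_window (hstat : IsStationary X μ) (m n : ℕ) :
    mutualInfo (lastPast m ∘ fun ω (s : Set.Iio (0 : ℤ)) => X s ω)
      (firstFuture n ∘ fun ω (s : Set.Ici (0 : ℤ)) => X s ω) μ =
    mutualInfo (block X m) (shiftBlock X m n) μ := by
  refine mutualInfo_congr ?_
  let u : (ℤ → ℝ) → (Fin m → ℝ) × (Fin n → ℝ) := fun x =>
    (fun i => x ((i : ℤ) + 1), fun i => x ((i : ℤ) + 1 + m))
  have hu : Measurable u := by fun_prop
  -- Shifting by -(m + 1) carries times 1, …, m to -m, …, -1, and m + 1 to 0.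
  convert! (hstat (-(m + 1))).comp hu using 1
  funext ω
  refine Prod.ext (funext fun i => ?_) (funext fun i => ?_)
  · simp only [lastPast, Function.comp_apply, u]
    congr 1
    ring
  · simp only [firstFuture, Function.comp_apply, u]
    congr 1
    ring

variable [IsProbabilityMeasure μ]

lemma mutualInfo_block_le_pastFutureInfo (hX : ∀ i, Measurable (X i)) (hstat : IsStationary X μ)
    (m n : ℕ) : mutualInfo (block X m) (shiftBlock X m n) μ ≤ pastFutureInfo X μ := by
  rw [← mutualInfo_window hstat]
  exact mutualInfo_comp_le (measurable_pi_lambda _ fun _ => hX _)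
    (measurable_pi_lambda _ fun _ => hX _) (measurable_lastPast m) (measurable_firstFuture n)

lemma pastFutureInfo_le (hX : ∀ i, Measurable (X i)) (hstat : IsStationary X μ) {C : ℝ≥0∞}
    (hC : ∀ n : ℕ, mutualInfo (block X n) (shiftBlock X n n) μ ≤ C) : pastFutureInfo X μ ≤ C := by
  have hU : Measurable fun ω (s : Set.Iio (0 : ℤ)) => X s ω := measurable_pi_lambda _ fun _ => hX _
  have hV : Measurable fun ω (s : Set.Ici (0 : ℤ)) => X s ω := measurable_pi_lambda _ fun _ => hX _
  refine klDiv_le_of_forall_klDiv_map_le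
    (fun n => (measurable_lastPast n).prodMap (measurable_firstFuture n))
    monotone_comap_window iSup_comap_window fun n => ?_
  rw [← map_prodMap_mutualInfo hU hV (measurable_lastPast n) (measurable_firstFuture n),
    mutualInfo_window hstat]
  exact hC n

/-- Lebesgue measure on `Fin 0 → ℝ` is the unit point mass, which is also the law of the empty
block. -/
lemma jointEntropy_zero : jointEntropy X μ 0 = 0 := by
  have hmap : μ.map (block X 0) = volume := by
    rw [Subsingleton.elim (block X 0) fun _ => isEmptyElim, Measure.map_const, measure_univ,
      one_smul, volume_pi, Measure.pi_of_empty]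
  have hone : density X μ 0 =ᵐ[volume] fun _ => 1 := by
    filter_upwards [Measure.rnDeriv_self (volume : Measure (Fin 0 → ℝ))] with x hx
    rw [density, pdf_def, hmap, hx, ENNReal.toReal_one]
  rw [jointEntropy, neg_eq_zero]
  refine integral_eq_zero_of_ae ?_
  filter_upwards [hone] with x hx
  simp [hx]

/-- Dropping the last of the n + 1 variables that follow X₁ cannot increase their information about
X₁, which is H(1) + H(n) - H(n+1) for n variables. -/
lemma antitone_jointEntropy_sub (hX : ∀ i, Measurable (X i)) (hstat : IsStationary X μ)
    (hent : HasFiniteEntropies X μ) :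
    Antitone fun n => jointEntropy X μ (n + 1) - jointEntropy X μ n := by
  refine antitone_nat_of_succ_le fun n => ?_
  have h : mutualInfo (block X 1) (shiftBlock X 1 n) μ ≤
      mutualInfo (block X 1) (shiftBlock X 1 (n + 1)) μ :=
    mutualInfo_comp_le (f := id) (g := fun x : Fin (n + 1) → ℝ => fun i : Fin n => x i.castSucc)
      (measurable_block hX 1) (measurable_shiftBlock hX 1 (n + 1)) measurable_id (by fun_prop)
  have h1 := mutualInfo_block_shiftBlock hX hstat hent 1 n
  have h2 := mutualInfo_block_shiftBlock hX hstat hent 1 (n + 1)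
  rw [Nat.cast_one] at h1 h2
  rw [h1.2, h2.2, ENNReal.ofReal_le_ofReal_iff h2.1, add_comm 1 n, add_comm 1 (n + 1)] at h
  linarith

end PastFuture

/-! ### Real sequences with monotone or convergent increments -/

section AntitoneIncrements

variable {H : ℕ → ℝ}

lemma tendsto_div_of_tendsto_sub {r : ℝ} (h0 : H 0 = 0)
    (h : Tendsto (fun n => H (n + 1) - H n) atTop (𝓝 r)) :
    Tendsto (fun n : ℕ => H n / n) atTop (𝓝 r) := by
  refine h.cesaro.congr fun n => ?_
  rw [Finset.sum_range_sub, h0, sub_zero, inv_mul_eq_div]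

lemma tendsto_div_atBot_of_antitone_sub (hanti : Antitone fun n => H (n + 1) - H n)
    (h : Tendsto (fun n => H (n + 1) - H n) atTop atBot) :
    Tendsto (fun n : ℕ => H n / n) atTop atBot := by
  refine tendsto_atBot.2 fun b => ?_
  -- Slope b - 1 instead of b leaves a slack of n, which absorbs the constant H N - N (b - 1) for
  -- large n.
  obtain ⟨N, hN⟩ := (tendsto_atBot.1 h (b - 1)).exists
  have hbound : ∀ k : ℕ, H (N + k) ≤ H N + k * (b - 1) := by
    intro k
    induction k with
    | zero => simp
    | succ k ih =>
      have := hanti (Nat.le_add_right N k)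
      push_cast
      rw [← add_assoc]
      simp only at this
      linarith
  obtain ⟨K, hK⟩ := exists_nat_ge (H N - N * (b - 1))
  filter_upwards [eventually_ge_atTop (max (max N K) 1)] with n hn
  have hNn : N ≤ n := (le_max_left _ _).trans ((le_max_left _ _).trans hn)
  have hKn : (K : ℝ) ≤ n := Nat.cast_le.2 ((le_max_right _ _).trans ((le_max_left _ _).trans hn))
  have hn0 : (0 : ℝ) < n := Nat.cast_pos.2 (lt_of_lt_of_le one_pos ((le_max_right _ _).trans hn))
  have := hbound (n - N)
  rw [Nat.add_sub_cancel' hNn, Nat.cast_sub hNn] at this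
  rw [div_le_iff₀ hn0]
  linarith

lemma tendsto_add_sub {r : ℝ} (h : Tendsto (fun n => H (n + 1) - H n) atTop (𝓝 r)) (m : ℕ) :
    Tendsto (fun n => H (m + n) - H n) atTop (𝓝 (m * r)) := by
  induction m with
  | zero => simp
  | succ m ih =>
    have h1 := h.comp (tendsto_add_atTop_nat m)
    have h2 := ih.add h1
    push_cast
    rw [add_mul, one_mul]
    refine h2.congr fun n => ?_
    simp only [Function.comp_apply]
    rw [show m + 1 + n = n + m + 1 by ring, show m + n = n + m by ring]
    ring

lemma monotone_sub_mul {r : ℝ} (hr : ∀ n, r ≤ H (n + 1) - H n) :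
    Monotone fun n : ℕ => H n - n * r := by
  refine monotone_nat_of_le_succ fun n => ?_
  have := hr n
  push_cast
  linarith

lemma mul_le_sub {r : ℝ} (hr : ∀ n, r ≤ H (n + 1) - H n) (m n : ℕ) : m * r ≤ H (m + n) - H n := by
  have := monotone_sub_mul hr (Nat.le_add_left n m)
  push_cast at this
  linarith

end AntitoneIncrements

/-! ### Entropy rate and excess entropy -/

section Rate

variable {Ω : Type*} [MeasurableSpace Ω] {μ : Measure Ω} {X : ℤ → Ω → ℝ}

lemma excessEntropySum_eq_top (hr : entropyRate X μ = ⊥) {N : ℕ} (hN : 0 < N) :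
    excessEntropySum X μ N = ⊤ := by
  obtain ⟨N, rfl⟩ := Nat.exists_eq_succ_of_ne_zero hN.ne'
  have h : ∀ N, excessEntropySum X μ (N + 1) = ⊤ := by
    intro N
    induction N with
    | zero => simp [excessEntropySum, hr]
    | succ N ih =>
      rw [excessEntropySum, Finset.sum_range_succ, ← excessEntropySum, ih, hr]
      simp
  exact h N

variable [IsProbabilityMeasure μ]

lemma tendsto_excess_of_tendsto (hX : ∀ i, Measurable (X i)) (hstat : IsStationary X μ)
    (hent : HasFiniteEntropies X μ) {r : ℝ}
    (h : Tendsto (fun n => jointEntropy X μ (n + 1) - jointEntropy X μ n) atTop (𝓝 r)) :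
    Tendsto (fun n : ℕ => ((jointEntropy X μ n - n * r : ℝ) : EReal)) atTop
      (𝓝 (pastFutureInfo X μ : EReal)) := by
  have hr : ∀ n, r ≤ jointEntropy X μ (n + 1) - jointEntropy X μ n :=
    (antitone_jointEntropy_sub hX hstat hent).le_of_tendsto h
  have hmono := monotone_sub_mul hr
  have hnonneg : ∀ n : ℕ, 0 ≤ jointEntropy X μ n - n * r := fun n => by
    simpa [jointEntropy_zero] using hmono (Nat.zero_le n)
  -- Upper bound from symmetric windows; lower bound by fixing the past length m and letting the
  -- future length grow.
  have heq : pastFutureInfo X μ = ⨆ n : ℕ, ENNReal.ofReal (jointEntropy X μ n - n * r) := by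
    refine le_antisymm (pastFutureInfo_le hX hstat fun n => ?_) (iSup_le fun m => ?_)
    · rw [(mutualInfo_block_shiftBlock hX hstat hent n n).2]
      refine le_iSup_of_le n (ENNReal.ofReal_le_ofReal ?_)
      linarith [mul_le_sub hr n n]
    · have hlim : Tendsto (fun n => jointEntropy X μ m + jointEntropy X μ n -
          jointEntropy X μ (m + n)) atTop (𝓝 (jointEntropy X μ m - m * r)) :=
        ((tendsto_add_sub h m).const_sub (jointEntropy X μ m)).congr fun n => by ring
      refine le_of_tendsto' (ENNReal.tendsto_ofReal hlim) fun n => ?_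
      rw [← (mutualInfo_block_shiftBlock hX hstat hent m n).2]
      exact mutualInfo_block_le_pastFutureInfo hX hstat m n
  have hlim : Tendsto (fun n : ℕ => ENNReal.ofReal (jointEntropy X μ n - n * r)) atTop
      (𝓝 (pastFutureInfo X μ)) :=
    heq ▸ tendsto_atTop_iSup fun a b hab => ENNReal.ofReal_le_ofReal (hmono hab)
  refine ((continuous_coe_ennreal_ereal.tendsto _).comp hlim).congr fun n => ?_
  rw [Function.comp_apply, EReal.coe_ennreal_ofReal, max_eq_left (hnonneg n)]

lemma pastFutureInfo_eq_top (hX : ∀ i, Measurable (X i)) (hstat : IsStationary X μ)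
    (hent : HasFiniteEntropies X μ)
    (h : Tendsto (fun n => jointEntropy X μ (n + 1) - jointEntropy X μ n) atTop atBot) :
    pastFutureInfo X μ = ∞ := by
  have hlim : Tendsto (fun n => jointEntropy X μ 1 + jointEntropy X μ n -
      jointEntropy X μ (1 + n)) atTop atTop :=
    (tendsto_atTop_add_const_left _ (jointEntropy X μ 1) (tendsto_neg_atBot_atTop.comp h)).congr
      fun n => by rw [Function.comp_apply, add_comm 1 n]; ring
  refine top_le_iff.1 (le_of_tendsto' (ENNReal.tendsto_ofReal_nhds_top.2 hlim) fun n => ?_)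
  rw [← (mutualInfo_block_shiftBlock hX hstat hent 1 n).2]
  exact mutualInfo_block_le_pastFutureInfo hX hstat 1 n

lemma excessEntropySum_eq (hX : ∀ i, Measurable (X i)) (hent : HasFiniteEntropies X μ)
    {r : ℝ} (hr : entropyRate X μ = r) (N : ℕ) :
    excessEntropySum X μ N = ((jointEntropy X μ N - N * r : ℝ) : EReal) := by
  induction N with
  | zero => simp [excessEntropySum, jointEntropy_zero]
  | succ N ih =>
    rw [excessEntropySum, Finset.sum_range_succ, ← excessEntropySum, ih, condEntropy_eq hX hent, hr,
      ← EReal.coe_sub, ← EReal.coe_add]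
    congr 1
    push_cast
    ring

lemma exists_entropyRate (hX : ∀ i, Measurable (X i)) (hstat : IsStationary X μ)
    (hent : HasFiniteEntropies X μ) :
    Tendsto (fun n : ℕ => ((jointEntropy X μ n / n : ℝ) : EReal)) atTop (𝓝 (entropyRate X μ)) ∧
    ((∃ r : ℝ, entropyRate X μ = r ∧
      Tendsto (fun n => jointEntropy X μ (n + 1) - jointEntropy X μ n) atTop (𝓝 r)) ∨
    (entropyRate X μ = ⊥ ∧
      Tendsto (fun n => jointEntropy X μ (n + 1) - jointEntropy X μ n) atTop atBot)) := by
  rcases tendsto_atTop_of_antitone (antitone_jointEntropy_sub hX hstat hent) with h | ⟨r, h⟩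
  · have hlim : Tendsto (fun n : ℕ => ((jointEntropy X μ n / n : ℝ) : EReal)) atTop (𝓝 ⊥) :=
      EReal.tendsto_coe_nhds_bot_iff.2
        (tendsto_div_atBot_of_antitone_sub (antitone_jointEntropy_sub hX hstat hent) h)
    have hrate : entropyRate X μ = ⊥ := hlim.limUnder_eq
    exact ⟨hrate ▸ hlim, Or.inr ⟨hrate, h⟩⟩
  · have hlim : Tendsto (fun n : ℕ => ((jointEntropy X μ n / n : ℝ) : EReal)) atTop (𝓝 r) :=
      EReal.tendsto_coe.2 (tendsto_div_of_tendsto_sub jointEntropy_zero h)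
    have hrate : entropyRate X μ = r := hlim.limUnder_eq
    exact ⟨hrate ▸ hlim, Or.inl ⟨r, hrate, h⟩⟩

lemma tendsto_excessEntropySum (hX : ∀ i, Measurable (X i)) (hstat : IsStationary X μ)
    (hent : HasFiniteEntropies X μ) :
    Tendsto (excessEntropySum X μ) atTop (𝓝 (pastFutureInfo X μ : EReal)) ∧
    Tendsto (fun n : ℕ => (jointEntropy X μ n : EReal) - (n : EReal) * entropyRate X μ) atTop
      (𝓝 (pastFutureInfo X μ : EReal)) := by
  rcases (exists_entropyRate hX hstat hent).2 with ⟨r, hr, h⟩ | ⟨hr, h⟩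
  · have hlim := tendsto_excess_of_tendsto hX hstat hent h
    refine ⟨hlim.congr fun n => (excessEntropySum_eq hX hent hr n).symm, hlim.congr fun n => ?_⟩
    rw [hr, EReal.coe_sub, EReal.coe_mul, EReal.coe_natCast]
  · rw [pastFutureInfo_eq_top hX hstat hent h, EReal.coe_ennreal_top]
    constructor
    · refine tendsto_const_nhds.congr' ?_
      filter_upwards [eventually_gt_atTop 0] with n hn
      exact (excessEntropySum_eq_top hr hn).symm
    · refine tendsto_const_nhds.congr' ?_
      -- The index 0 is excluded because `0 * ⊥ = 0` in `EReal`.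
      filter_upwards [eventually_gt_atTop 0] with n hn
      rw [hr, EReal.mul_bot_of_pos (by exact_mod_cast hn)]
      simp

end Rate

end DiffEntropy

theorem mainTheorem1 {Ω : Type*} [MeasurableSpace Ω] (μ : Measure Ω) [IsProbabilityMeasure μ]
    (X : ℤ → Ω → ℝ) (hX : ∀ i, Measurable (X i))
    (hstat : DiffEntropy.IsStationary X μ) (hent : DiffEntropy.HasFiniteEntropies X μ) :
    -- the entropy rate exists in `[-∞, ∞)`
    Tendsto (fun n : ℕ => ((DiffEntropy.jointEntropy X μ n / n : ℝ) : EReal)) atTop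
        (𝓝 (DiffEntropy.entropyRate X μ)) ∧
      DiffEntropy.entropyRate X μ ≠ ⊤ ∧
    -- the series defining the excess entropy converges in `[0, ∞]`, and so does its closed form
    Tendsto (DiffEntropy.excessEntropySum X μ) atTop (𝓝 (DiffEntropy.excessEntropy X μ)) ∧
    Tendsto (fun n : ℕ => (DiffEntropy.jointEntropy X μ n : EReal)
        - (n : EReal) * DiffEntropy.entropyRate X μ) atTop (𝓝 (DiffEntropy.excessEntropy X μ)) ∧
    -- past-future mutual information equals excess entropy
    ((DiffEntropy.pastFutureInfo X μ : ℝ≥0∞) : EReal) = DiffEntropy.excessEntropy X μ := by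
  obtain ⟨hrate, hcase⟩ := DiffEntropy.exists_entropyRate hX hstat hent
  obtain ⟨hsum, hclosed⟩ := DiffEntropy.tendsto_excessEntropySum hX hstat hent
  have hE : DiffEntropy.excessEntropy X μ = (DiffEntropy.pastFutureInfo X μ : EReal) :=
    hsum.limUnder_eq
  refine ⟨hrate, ?_, hE ▸ hsum, hE ▸ hclosed, hE.symm⟩
  rcases hcase with ⟨r, hr, -⟩ | ⟨hr, -⟩ <;> simp [hr]
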